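/- Let $\mathcal S$ be the set of density operators on $\mathbb C^d$, $d\in\mathbb N$ (positive semidefinite $d\times d$ matrices of trace one, with the usual topology), and let $p:\mathcal S\to X$ be a continuous map onto a locally compact, separable metric space $X$ with Borel $\sigma$-algebra $\mathfrak B(X)$. A $p$-estimation scheme is a sequence $(E_N)_{N\in\mathbb N}$ of normalized POV measures $E_N:\mathfrak B(X)\to\mathcal B((\mathbb C^d)^{\otimes N})$ (that is, $E_N$ is $\sigma$-additive, $E_N(\Delta)\ge 0$ and $E_N(X)=\mathbb 1$); it yields the probability measures $\mu_{N,\rho}(\Delta)=\operatorname{tr}\bigl(\rho^{\otimes N}E_N(\Delta)\bigr)$, $\rho\in\mathcal S$. A function $I:\mathcal S\times X\to[0,\infty]$ is called $p$-admissible if there is a $p$-estimation scheme $(E_N)_{N\in\mathbb N}$ such that, for every $\rho\in\mathcal S$: 1. $I(\rho,\cdot)$ is not identically $\infty$, is lower semicontinuous, and has compact level sets $\{x\in X: I(\rho,x)\le c\}$, $c\in\mathbb R$; 2. for all $x \in X$: $I(\rho,x)=0$ if and only if $p(\rho)=x$; 3. $(\mu_{N,\rho})_{N\in\mathbb N}$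 satisfies the large deviation principle with rate function $I(\rho,\cdot)$: $$\limsup_{N\to\infty}\tfrac1N\ln\mu_{N,\rho}(\Delta)\le-\inf_{x\in\Delta}I(\rho,x)\quad\text{for every closed }\Delta\subset X,$$ $$\liminf_{N\to\infty}\tfrac1N\ln\mu_{N,\rho}(\Delta)\ge-\inf_{x\in\Delta}I(\rho,x)\quad\text{for every open }\Delta\subset X.$$ Here $\ln 0=-\infty$ and $\inf\emptyset=\infty$. Let $\mathcal E(p)$ be the set of all $p$-admissible functions, and let $$\mathcal I_p(\rho,x)=\sup_{I\in\mathcal E(p)}I(\rho,x)\in[0,\infty]$$ be the optimal rate function of $p$-estimation (with $\sup\emptyset=0$). For $\rho,\sigma\in\mathcal S$ let $S(\rho,\sigma)=\operatorname{tr}(\sigma\ln\sigma-\sigma\ln\rho)$ if $\ker\rho\subseteq\ker\sigma$, and $S(\rho,\sigma)=+\infty$ otherwise, be the quantum relative entropy. **Theorem.** For all $\rho\in\mathcal S$ and all $x\in X$, $$\mathcal I_p(\rho,x)\le\inf_{\sigma\in p^{-1}(x)}S(\rho,\sigma).$$ -/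

import Mathlib

open MeasureTheory Filter Topology
open scoped ENNReal NNReal ComplexOrder

namespace QuantumEstimation

noncomputable section

/-! ### States and tensor powers -/

/-- The set of density operators on `ℂ^d` (positive semidefinite matrices of trace one), with the
topology inherited from the space of matrices. -/
abbrev DensityMatrix (d : ℕ) : Type :=
  {ρ : Matrix (Fin d) (Fin d) ℂ // ρ.PosSemidef ∧ ρ.trace = 1}

/-- The `N`-fold tensor power of an operator on `ℂ^d`, as a matrix in the product basis
`e_{i 0} ⊗ ⋯ ⊗ e_{i (N-1)}` of `(ℂ^d)^{⊗N}`, indexed by `i : Fin N → Fin d`. -/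
def tensorPower {d : ℕ} (N : ℕ) (A : Matrix (Fin d) (Fin d) ℂ) :
    Matrix (Fin N → Fin d) (Fin N → Fin d) ℂ :=
  Matrix.of fun i j => ∏ k, A (i k) (j k)

theorem tensorPower_mul {d : ℕ} (N : ℕ) (A B : Matrix (Fin d) (Fin d) ℂ) :
    tensorPower N (A * B) = tensorPower N A * tensorPower N B := by
  ext i j
  simp only [tensorPower, Matrix.of_apply, Matrix.mul_apply]
  rw [Finset.prod_univ_sum, Fintype.piFinset_univ]
  simp only [Finset.prod_mul_distrib]

theorem tensorPower_conjTranspose {d : ℕ} (N : ℕ) (A : Matrix (Fin d) (Fin d) ℂ) :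
    tensorPower N A.conjTranspose = (tensorPower N A).conjTranspose := by
  ext i j
  simp [tensorPower, Matrix.conjTranspose_apply]

open scoped MatrixOrder in
theorem tensorPower_posSemidef {d : ℕ} (N : ℕ) {A : Matrix (Fin d) (Fin d) ℂ}
    (hA : A.PosSemidef) : (tensorPower N A).PosSemidef := by
  obtain ⟨B, rfl⟩ := CStarAlgebra.nonneg_iff_eq_star_mul_self.mp hA.nonneg
  rw [tensorPower_mul, Matrix.star_eq_conjTranspose, tensorPower_conjTranspose]
  exact Matrix.posSemidef_conjTranspose_mul_self _

theorem tensorPower_trace {d : ℕ} (N : ℕ) (A : Matrix (Fin d) (Fin d) ℂ) :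
    (tensorPower N A).trace = A.trace ^ N := by
  simp only [tensorPower, Matrix.trace, Matrix.diag_apply, Matrix.of_apply]
  rw [← Fintype.piFinset_univ, Finset.sum_prod_piFinset (Finset.univ) (fun _ i => A i i)]
  simp

open scoped MatrixOrder in
theorem trace_mul_re_nonneg {n : Type*} [Fintype n] [DecidableEq n] {A B : Matrix n n ℂ}
    (hA : A.PosSemidef) (hB : B.PosSemidef) : 0 ≤ (A * B).trace.re := by
  obtain ⟨C, rfl⟩ := CStarAlgebra.nonneg_iff_eq_star_mul_self.mp hA.nonneg
  rw [Matrix.star_eq_conjTranspose, Matrix.mul_assoc, Matrix.trace_mul_comm]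
  exact (Complex.le_def.mp (hB.mul_mul_conjTranspose_same C).trace_nonneg).1

/-! ### POV measures and estimation schemes -/

/-- A normalized positive operator valued measure on `X`: a `σ`-additive set function on the
`σ`-algebra of `X` whose values are positive semidefinite matrices, with `E univ = 1`. -/
structure POVM (X : Type*) [MeasurableSpace X] (n : Type*) [Fintype n] [DecidableEq n] where
  /-- the underlying `σ`-additive set function (with value `0` on non-measurable sets) -/
  toVectorMeasure : VectorMeasure X (Matrix n n ℂ)
  posSemidef : ∀ Δ : Set X, MeasurableSet Δ → (toVectorMeasure Δ).PosSemidef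
  univ_eq_one : toVectorMeasure Set.univ = 1

/-- The distribution `Δ ↦ tr (ρ^{⊗N} E(Δ))` of the outcome when `E` is measured on `N` systems, all
prepared in the state `ρ`. -/
def outcomeMeasure {X : Type*} [MeasurableSpace X] {d N : ℕ} (E : POVM X (Fin N → Fin d))
    (ρ : DensityMatrix d) : Measure X :=
  Measure.ofMeasurable
    (fun Δ _ => ENNReal.ofReal (tensorPower N ρ.1 * E.toVectorMeasure Δ).trace.re)
    (by simp)
    (by
      intro f hf hd
      have h := E.toVectorMeasure.m_iUnion hf hd
      let L : Matrix (Fin N → Fin d) (Fin N → Fin d) ℂ →+ ℝ :=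
        { toFun := fun M => (tensorPower N ρ.1 * M).trace.re
          map_zero' := by simp
          map_add' := fun A B => by simp [Matrix.mul_add] }
      have hL : Continuous L :=
        Complex.continuous_re.comp (continuous_const.matrix_mul continuous_id).matrix_trace
      have h2 := h.map L hL
      have h3 := ENNReal.ofReal_tsum_of_nonneg
        (fun i => trace_mul_re_nonneg (tensorPower_posSemidef N ρ.2.1)
          (E.posSemidef (f i) (hf i))) h2.summable
      rw [← h3]
      exact congrArg ENNReal.ofReal h2.tsum_eq.symm)

theorem outcomeMeasure_apply {X : Type*} [MeasurableSpace X] {d N : ℕ}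
    (E : POVM X (Fin N → Fin d)) (ρ : DensityMatrix d) {Δ : Set X} (hΔ : MeasurableSet Δ) :
    outcomeMeasure E ρ Δ
      = ENNReal.ofReal (tensorPower N ρ.1 * E.toVectorMeasure Δ).trace.re :=
  Measure.ofMeasurable_apply Δ hΔ

instance {X : Type*} [MeasurableSpace X] {d N : ℕ} (E : POVM X (Fin N → Fin d))
    (ρ : DensityMatrix d) : IsProbabilityMeasure (outcomeMeasure E ρ) :=
  ⟨by
    rw [outcomeMeasure_apply E ρ MeasurableSet.univ, E.univ_eq_one, Matrix.mul_one,
      tensorPower_trace, ρ.2.2]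
    simp⟩

/-- An estimation scheme with values in `X`: for every `N` a POV measure on `X` acting on the
`N`-fold system `(ℂ^d)^{⊗N}`. -/
abbrev EstimationScheme (d : ℕ) (X : Type*) [MeasurableSpace X] : Type _ :=
  (N : ℕ) → POVM X (Fin N → Fin d)

/-! ### Large deviations -/

/-- Rate functions: not identically `∞`, lower semicontinuous, with compact level sets. -/
structure IsRateFunction {X : Type*} [TopologicalSpace X] (I : X → ℝ≥0∞) : Prop where
  ne_top : ∃ x, I x ≠ ⊤
  lowerSemicontinuous : LowerSemicontinuous I
  isCompact_level : ∀ c : ℝ≥0, IsCompact {x | I x ≤ c}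

/-- The large deviation principle for a sequence of probability measures `μ N`, with rate
function `I`; all logarithms and infima are taken in `[-∞, ∞]`, with `log 0 = -∞` and
`inf ∅ = ∞`. -/
structure SatisfiesLDP {X : Type*} [TopologicalSpace X] [MeasurableSpace X]
    (μ : ℕ → Measure X) [∀ N, IsProbabilityMeasure (μ N)] (I : X → ℝ≥0∞) : Prop where
  isRateFunction : IsRateFunction I
  upper_bound : ∀ Δ : Set X, IsClosed Δ →
    limsup (fun N : ℕ => ENNReal.log (μ N Δ) / (N : EReal)) atTop
      ≤ -((⨅ x ∈ Δ, I x : ℝ≥0∞) : EReal)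
  lower_bound : ∀ Δ : Set X, IsOpen Δ →
    -((⨅ x ∈ Δ, I x : ℝ≥0∞) : EReal)
      ≤ liminf (fun N : ℕ => ENNReal.log (μ N Δ) / (N : EReal)) atTop

/-- The estimation scheme `E`, regarded as a scheme for estimating `p ρ`, satisfies the large
deviation principle with rate function `I`. -/
structure EstimationScheme.HasRateFunction {d : ℕ} {X : Type*} [TopologicalSpace X]
    [MeasurableSpace X] (E : EstimationScheme d X) (p : DensityMatrix d → X)
    (I : DensityMatrix d → X → ℝ≥0∞) : Prop where
  isRateFunction : ∀ ρ, IsRateFunction (I ρ)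
  eq_zero_iff : ∀ ρ x, I ρ x = 0 ↔ p ρ = x
  ldp : ∀ ρ, SatisfiesLDP (fun N => outcomeMeasure (E N) ρ) (I ρ)

/-- The set of `p`-admissible rate functions, i.e. of rate functions of `p`-estimation schemes. -/
def admissibleRateFunctions {d : ℕ} {X : Type*} [TopologicalSpace X] [MeasurableSpace X]
    (p : DensityMatrix d → X) : Set (DensityMatrix d → X → ℝ≥0∞) :=
  {I | ∃ E : EstimationScheme d X, E.HasRateFunction p I}

/-- The optimal rate function of `p`-estimation: the pointwise supremum (in `[0, ∞]`) of all
`p`-admissible rate functions. -/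
def optimalRateFunction {d : ℕ} {X : Type*} [TopologicalSpace X] [MeasurableSpace X]
    (p : DensityMatrix d → X) (ρ : DensityMatrix d) (x : X) : ℝ≥0∞ :=
  ⨆ I ∈ admissibleRateFunctions p, I ρ x

/-! ### Relative entropy -/

open Classical in
/-- The quantum relative entropy `S(ρ, σ) = tr (σ ln σ - σ ln ρ)`, which is `+∞` unless
`ker ρ ⊆ ker σ`. The logarithm is the functional calculus with `Real.log`; its convention
`log 0 = 0` yields `0 ln 0 = 0` in `σ ln σ` and is irrelevant in `σ ln ρ`, because `σ` vanishes on
`ker ρ` in the case where the formula is used. -/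
def relativeEntropy {d : ℕ} (ρ σ : DensityMatrix d) : EReal :=
  if LinearMap.ker (Matrix.toLin' ρ.1) ≤ LinearMap.ker (Matrix.toLin' σ.1) then
    (((σ.1 * cfc Real.log σ.1 - σ.1 * cfc Real.log ρ.1).trace.re : ℝ) : EReal)
  else ⊤

end

end QuantumEstimation

open scoped Matrix

namespace QuantumEstimation

/-! ### A lower bound for the error of binary tests -/

section Test

variable {n : Type*} [Fintype n] [DecidableEq n]

/-! Let `E` be a scheme with rate function `I`, and let `p σ = x`. Since `I σ` vanishes only at `x`,
outcomes under `σ` concentrate in any ball around `x`. The effect of that ball is thus a test of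
`ρ^{⊗N}` against `σ^{⊗N}` that rarely rejects `σ`, so by Stein's converse
(`exists_one_sub_pow_le_trace`) its probability under `ρ` is at least a constant times `e^(-Nc)`,
for every `c > S(ρ, σ)`. The upper large deviation bound then gives `inf I ρ ≤ c` on the closed
ball, and lower semicontinuity lets the ball shrink to `x`.

Stein's converse reduces to a classical statement. With eigenvalues `a i` of `ρ`, `b j` of `σ` and
squared overlaps `w` of the eigenvectors, the Nussbaum–Szkoła weights `a i * w (i, j)` and `b j * w
(i, j)` have relative entropy `S(ρ, σ)` and are compatible with tensor powers.
`sum_min_mul_normSq_le_trace` bounds quantum errors below by their overlap, which a Chernoff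
estimate controls. -/

theorem posSemidef_sub_mul_self {T : Matrix n n ℂ} (hT : T.PosSemidef)
    (hT' : (1 - T).PosSemidef) : (T - T * T).PosSemidef := by
  have h1 := hT'.mul_mul_conjTranspose_same T
  have h2 := hT.mul_mul_conjTranspose_same (1 - T)
  rw [hT.isHermitian.eq] at h1
  rw [hT'.isHermitian.eq] at h2
  -- `T - T² = T(1 - T)T + (1 - T)T(1 - T)`.
  convert h1.add h2 using 1
  noncomm_ring

/-- The trace is `∑ a i ⟨v i, T v i⟩` over the columns `v i` of `V`. Now `T ≥ T²`, and Parseval in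
the columns of `W` expands `⟨v i, T² v i⟩`. -/
theorem sum_mul_normSq_le_trace {V W T : Matrix n n ℂ} (hW : W * Wᴴ = 1)
    {a : n → ℝ} (ha : ∀ i, 0 ≤ a i) (hT : T.PosSemidef) (hT' : (1 - T).PosSemidef) :
    ∑ i, ∑ j, a i * Complex.normSq ((Vᴴ * T * W) i j)
      ≤ (V * Matrix.diagonal (fun i => (a i : ℂ)) * Vᴴ * T).trace.re := by
  have e1 : (V * Matrix.diagonal (fun i => (a i : ℂ)) * Vᴴ * T).trace.re
      = ∑ i, a i * ((Vᴴ * T * V) i i).re := by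
    rw [Matrix.mul_assoc, Matrix.mul_assoc, Matrix.trace_mul_comm, Matrix.mul_assoc, Matrix.trace,
      Complex.re_sum]
    simp [Matrix.diagonal_mul]
  rw [e1]
  refine Finset.sum_le_sum fun i _ => ?_
  rw [← Finset.mul_sum]
  refine mul_le_mul_of_nonneg_left ?_ (ha i)
  have e2 : (Vᴴ * T * W) * (Vᴴ * T * W)ᴴ = Vᴴ * (T * T) * V := by
    simp only [Matrix.conjTranspose_mul, Matrix.conjTranspose_conjTranspose, hT.isHermitian.eq]
    calc Vᴴ * T * W * (Wᴴ * (T * V)) = Vᴴ * T * (W * Wᴴ) * T * V := by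
          simp only [Matrix.mul_assoc]
      _ = _ := by rw [hW]; simp only [Matrix.mul_assoc, Matrix.one_mul]
  have e3 : ∑ j, Complex.normSq ((Vᴴ * T * W) i j) = ((Vᴴ * (T * T) * V) i i).re := by
    rw [← e2, Matrix.mul_apply, Complex.re_sum]
    refine Finset.sum_congr rfl fun j _ => ?_
    rw [Matrix.conjTranspose_apply, RCLike.star_def, Complex.mul_conj, Complex.ofReal_re]
  rw [e3]
  have h := ((posSemidef_sub_mul_self hT hT').conjTranspose_mul_mul_same V).diag_nonneg (i := i)
  have h' := (Complex.le_def.mp h).1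
  rw [Matrix.mul_sub, Matrix.sub_mul, Matrix.sub_apply, Complex.zero_re, Complex.sub_re] at h'
  linarith

theorem normSq_add_le (z w : ℂ) :
    Complex.normSq (z + w) ≤ 2 * (Complex.normSq z + Complex.normSq w) := by
  simp only [Complex.normSq_apply, Complex.add_re, Complex.add_im]
  nlinarith [sq_nonneg (z.re - w.re), sq_nonneg (z.im - w.im)]

/-- The sum of the two error probabilities of a binary quantum test is at least half of the error
sum of the optimal classical test between the Nussbaum–Szkoła distributions. -/
theorem sum_min_mul_normSq_le_trace {V W T : Matrix n n ℂ} (hV : V * Vᴴ = 1) (hW : W * Wᴴ = 1)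
    {a b : n → ℝ} (ha : ∀ i, 0 ≤ a i) (hb : ∀ i, 0 ≤ b i) (hT : T.PosSemidef)
    (hT' : (1 - T).PosSemidef) :
    (∑ i, ∑ j, min (a i) (b j) * Complex.normSq ((Vᴴ * W) i j)) / 2
      ≤ (V * Matrix.diagonal (fun i => (a i : ℂ)) * Vᴴ * T).trace.re
        + (W * Matrix.diagonal (fun i => (b i : ℂ)) * Wᴴ * (1 - T)).trace.re := by
  have h1 := sum_mul_normSq_le_trace (V := V) hW ha hT hT'
  have h2 := sum_mul_normSq_le_trace (V := W) hV hb hT' (by simpa using hT)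
  rw [Finset.sum_comm] at h2
  refine le_trans ?_ (add_le_add h1 h2)
  rw [← Finset.sum_add_distrib, Finset.sum_div]
  refine Finset.sum_le_sum fun i _ => ?_
  rw [← Finset.sum_add_distrib, Finset.sum_div]
  refine Finset.sum_le_sum fun j _ => ?_
  have e : Complex.normSq ((Wᴴ * (1 - T) * V) j i)
      = Complex.normSq ((Vᴴ * (1 - T) * W) i j) := by
    have : (Wᴴ * (1 - T) * V) = (Vᴴ * (1 - T) * W)ᴴ := by
      rw [Matrix.conjTranspose_mul, Matrix.conjTranspose_mul, hT'.isHermitian.eq,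
        Matrix.conjTranspose_conjTranspose, Matrix.mul_assoc]
    rw [this, Matrix.conjTranspose_apply, RCLike.star_def, Complex.normSq_conj]
  -- Inserting `1 = T + (1 - T)` splits the overlap between the two errors; `|z + w|² ≤ 2(|z|² +
  -- |w|²)` costs the factor one half.
  have e' : (Vᴴ * W) i j = (Vᴴ * T * W) i j + (Vᴴ * (1 - T) * W) i j := by
    rw [← Matrix.add_apply, ← Matrix.add_mul, ← Matrix.mul_add, add_sub_cancel, Matrix.mul_one]
  rw [e, e']
  have h := normSq_add_le ((Vᴴ * T * W) i j) ((Vᴴ * (1 - T) * W) i j)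
  have hm : 0 ≤ min (a i) (b j) := le_min (ha i) (hb j)
  have k1 := mul_le_mul_of_nonneg_right (min_le_left (a i) (b j))
    (Complex.normSq_nonneg ((Vᴴ * T * W) i j))
  have k2 := mul_le_mul_of_nonneg_right (min_le_right (a i) (b j))
    (Complex.normSq_nonneg ((Vᴴ * (1 - T) * W) i j))
  have k3 := mul_le_mul_of_nonneg_left h hm
  linarith

end Test

/-! ### Classical estimates -/

section Classical

variable {ι : Type*} [Fintype ι]

/-- Chernoff bound: if the mean of `l` is less than `c`, then the exponential moment of `l - c` is
less than one for some positive parameter. -/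
theorem exists_sum_mul_exp_lt_one {q l : ι → ℝ} (hq1 : ∑ i, q i = 1) {c : ℝ}
    (hc : ∑ i, q i * l i < c) :
    ∃ s : ℝ, 0 < s ∧ ∑ i, q i * Real.exp (s * (l i - c)) < 1 := by
  -- The moment equals 1 at `s = 0` and has negative derivative there, namely the mean of `l` minus
  -- `c`.
  have hd : HasDerivAt (fun s : ℝ => ∑ i, q i * Real.exp (s * (l i - c)))
      (∑ i, q i * (l i - c)) 0 := by
    refine HasDerivAt.fun_sum fun i _ => ?_
    have := (((hasDerivAt_id (0 : ℝ)).mul_const (l i - c)).exp).const_mul (q i)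
    simpa using this
  have hneg : ∑ i, q i * (l i - c) < 0 := by
    simp only [mul_sub, Finset.sum_sub_distrib, ← Finset.sum_mul, hq1]
    linarith
  have h := (hd.hasDerivWithinAt (s := Set.Ioi 0)).limsup_slope_le' (lt_irrefl _) hneg
  obtain ⟨s, hs, hs0⟩ := (h.and self_mem_nhdsWithin).exists
  refine ⟨s, hs0, ?_⟩
  rw [slope_def_field, div_lt_iff₀ (by simpa using hs0)] at hs
  simp only [zero_mul, Real.exp_zero, mul_one, hq1] at hs
  linarith

/-- If `q ≤ e^l p`, then the overlap of `e^(Nc) p^N` with `q^N` tends to one exponentially fast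
whenever the bound on its exponential moment is less than one. -/
theorem one_sub_pow_le_sum_min [DecidableEq ι] {p q l : ι → ℝ} (hp : ∀ i, 0 ≤ p i)
    (hq : ∀ i, 0 ≤ q i)
    (hq1 : ∑ i, q i = 1) (hle : ∀ i, q i ≤ Real.exp (l i) * p i) {c s : ℝ} (hs : 0 < s) (N : ℕ) :
    1 - (∑ i, q i * Real.exp (s * (l i - c))) ^ N
      ≤ ∑ k : Fin N → ι, min (Real.exp (N * c) * ∏ t, p (k t)) (∏ t, q (k t)) := by
  have e1 : ∀ f : ι → ℝ, (∑ i, f i) ^ N = ∑ k : Fin N → ι, ∏ t, f (k t) := by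
    intro f
    rw [← Fintype.piFinset_univ, Finset.sum_prod_piFinset (Finset.univ) (fun _ i => f i)]
    simp
  have e2 : (1 : ℝ) = ∑ k : Fin N → ι, ∏ t, q (k t) := by rw [← e1, hq1, one_pow]
  rw [e1, e2, ← Finset.sum_sub_distrib]
  refine Finset.sum_le_sum fun k _ => ?_
  have hQ : 0 ≤ ∏ t, q (k t) := Finset.prod_nonneg fun t _ => hq _
  have hP : 0 ≤ ∏ t, p (k t) := Finset.prod_nonneg fun t _ => hp _
  have hQP : ∏ t, q (k t) ≤ Real.exp (∑ t, l (k t)) * ∏ t, p (k t) := by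
    rw [Real.exp_sum, ← Finset.prod_mul_distrib]
    exact Finset.prod_le_prod (fun t _ => hq _) fun t _ => hle _
  have e3 : ∏ t, q (k t) * Real.exp (s * (l (k t) - c))
      = (∏ t, q (k t)) * Real.exp (s * (∑ t, l (k t) - N * c)) := by
    rw [Finset.prod_mul_distrib, ← Real.exp_sum, ← Finset.mul_sum, Finset.sum_sub_distrib]
    simp
  rw [e3]
  -- Below the threshold the minimum dominates the `q`-product; above it the exponential is at least
  -- 1, so the left side is nonpositive.
  rcases le_total (∑ t, l (k t)) (N * c) with h | h
  · refine le_min ?_ ?_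
    · calc _ ≤ ∏ t, q (k t) := sub_le_self _ (by positivity)
        _ ≤ _ := hQP
        _ ≤ _ := mul_le_mul_of_nonneg_right (Real.exp_le_exp.mpr h) hP
    · exact sub_le_self _ (by positivity)
  · have h1 : 1 ≤ Real.exp (s * (∑ t, l (k t) - N * c)) :=
      Real.one_le_exp (mul_nonneg hs.le (sub_nonneg.mpr h))
    have h2 := mul_le_mul_of_nonneg_left h1 hQ
    have h3 : 0 ≤ min (Real.exp (N * c) * ∏ t, p (k t)) (∏ t, q (k t)) :=
      le_min (by positivity) hQ
    linarith

end Classical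

/-! ### Spectral decomposition and tensor powers -/

theorem tensorPower_one {d : ℕ} (N : ℕ) :
    tensorPower N (1 : Matrix (Fin d) (Fin d) ℂ) = 1 := by
  ext i j
  rw [tensorPower, Matrix.of_apply, Matrix.one_apply]
  simp only [Matrix.one_apply, Finset.prod_ite_zero, Finset.prod_const_one, funext_iff,
    Finset.mem_univ, true_implies]

theorem tensorPower_diagonal {d : ℕ} (N : ℕ) (a : Fin d → ℝ) :
    tensorPower N (Matrix.diagonal fun i => (a i : ℂ))
      = Matrix.diagonal fun i => ((∏ t, a (i t) : ℝ) : ℂ) := by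
  ext i j
  rw [tensorPower, Matrix.of_apply, Matrix.diagonal_apply]
  simp only [Matrix.diagonal_apply, Finset.prod_ite_zero, funext_iff, Finset.mem_univ,
    true_implies, Complex.ofReal_prod]

theorem exists_eq_mul_diagonal_mul {d : ℕ} {A : Matrix (Fin d) (Fin d) ℂ} (hA : A.PosSemidef) :
    ∃ (V : Matrix (Fin d) (Fin d) ℂ) (a : Fin d → ℝ), V * Vᴴ = 1 ∧ Vᴴ * V = 1 ∧ (∀ i, 0 ≤ a i) ∧
      A = V * Matrix.diagonal (fun i => (a i : ℂ)) * Vᴴ ∧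
      cfc Real.log A = V * Matrix.diagonal (fun i => (Real.log (a i) : ℂ)) * Vᴴ := by
  refine ⟨hA.isHermitian.eigenvectorUnitary, hA.isHermitian.eigenvalues, ?_, ?_,
    hA.eigenvalues_nonneg, ?_, ?_⟩
  · exact Unitary.mul_star_self_of_mem (hA.isHermitian.eigenvectorUnitary).2
  · exact Unitary.star_mul_self_of_mem (hA.isHermitian.eigenvectorUnitary).2
  · exact hA.isHermitian.spectral_theorem
  · rw [hA.isHermitian.cfc_eq]
    rfl

/-- Expresses traces of products with different eigenbases as sums over pairs of eigenvectors;
taking one spectrum constantly 1 gives traces of a single operator. -/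
theorem trace_mul_diagonal_mul {n : Type*} [Fintype n] [DecidableEq n] {V W : Matrix n n ℂ}
    (a b : n → ℝ) :
    (W * Matrix.diagonal (fun i => (b i : ℂ)) * Wᴴ
        * (V * Matrix.diagonal (fun i => (a i : ℂ)) * Vᴴ)).trace.re
      = ∑ i, ∑ j, a i * b j * Complex.normSq ((Vᴴ * W) i j) := by
  have e : (W * Matrix.diagonal (fun i => (b i : ℂ)) * Wᴴ
        * (V * Matrix.diagonal (fun i => (a i : ℂ)) * Vᴴ)).trace
      = ((Vᴴ * W) * (Matrix.diagonal (fun i => (b i : ℂ)) * (Vᴴ * W)ᴴ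
        * Matrix.diagonal (fun i => (a i : ℂ)))).trace := by
    rw [← Matrix.mul_assoc, Matrix.trace_mul_comm]
    simp only [Matrix.conjTranspose_mul, Matrix.conjTranspose_conjTranspose, Matrix.mul_assoc]
  rw [e, Matrix.trace, Complex.re_sum]
  refine Finset.sum_congr rfl fun i _ => ?_
  rw [Matrix.diag_apply, Matrix.mul_apply, Complex.re_sum]
  refine Finset.sum_congr rfl fun j _ => ?_
  rw [Matrix.mul_diagonal, Matrix.diagonal_mul, Matrix.conjTranspose_apply, RCLike.star_def]
  have : (Vᴴ * W) i j * ((b j : ℂ) * (starRingEnd ℂ) ((Vᴴ * W) i j) * (a i : ℂ))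
      = ((a i * b j * Complex.normSq ((Vᴴ * W) i j) : ℝ) : ℂ) := by
    push_cast
    rw [← Complex.mul_conj]
    ring
  rw [this, Complex.ofReal_re]

/-- Quantum Stein lemma (converse part), in the form of a bound for the sum of the two error
probabilities of a test between `ρ^{⊗N}` and `σ^{⊗N}`. -/
theorem exists_one_sub_pow_le_trace {d : ℕ} (ρ σ : DensityMatrix d)
    (hker : LinearMap.ker (Matrix.toLin' ρ.1) ≤ LinearMap.ker (Matrix.toLin' σ.1)) {c : ℝ}
    (hc : (σ.1 * cfc Real.log σ.1 - σ.1 * cfc Real.log ρ.1).trace.re < c) :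
    ∃ g : ℝ, 0 ≤ g ∧ g < 1 ∧ ∀ (N : ℕ) (T : Matrix (Fin N → Fin d) (Fin N → Fin d) ℂ),
      T.PosSemidef → (1 - T).PosSemidef →
      (1 - g ^ N) / 2 ≤ Real.exp (N * c) * (tensorPower N ρ.1 * T).trace.re
        + (tensorPower N σ.1 * (1 - T)).trace.re := by
  obtain ⟨V, a, hV, hV', ha, hρ, hlρ⟩ := exists_eq_mul_diagonal_mul ρ.2.1
  obtain ⟨W, b, hW, hW', hb, hσ, hlσ⟩ := exists_eq_mul_diagonal_mul σ.2.1
  have htr := σ.2.2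
  generalize σ.1 = B at *
  generalize ρ.1 = A at *
  set w : Fin d × Fin d → ℝ := fun k => Complex.normSq ((Vᴴ * W) k.1 k.2) with hw
  have hw0 : ∀ k, 0 ≤ w k := fun k => Complex.normSq_nonneg _
  -- The Nussbaum–Szkoła weights and their log-likelihood ratio `l`.
  set p : Fin d × Fin d → ℝ := fun k => a k.1 * w k with hp
  set q : Fin d × Fin d → ℝ := fun k => b k.2 * w k with hq
  set l : Fin d × Fin d → ℝ := fun k => Real.log (b k.2) - Real.log (a k.1) with hl
  have hp0 : ∀ k, 0 ≤ p k := fun k => mul_nonneg (ha _) (hw0 k)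
  have hq0 : ∀ k, 0 ≤ q k := fun k => mul_nonneg (hb _) (hw0 k)
  have hq1 : ∑ k, q k = 1 := by
    have h := trace_mul_diagonal_mul (V := V) (W := W) (fun _ => 1) b
    rw [← hσ] at h
    simp only [Complex.ofReal_one, Matrix.diagonal_one, Matrix.mul_one, hV, htr, Complex.one_re,
      one_mul] at h
    rw [Fintype.sum_prod_type, h]
  have hql : ∑ k, q k * l k = (B * cfc Real.log B - B * cfc Real.log A).trace.re := by
    have h1 : (B * cfc Real.log B).trace.re
        = ∑ k, b k.2 * Real.log (b k.2) * w k := by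
      have h := trace_mul_diagonal_mul (V := V) (W := W) (fun _ => 1)
        (fun j => b j * Real.log (b j))
      simp only [Complex.ofReal_one, Matrix.diagonal_one, Matrix.mul_one, hV, one_mul] at h
      rw [Fintype.sum_prod_type, ← h, hlσ, hσ]
      congr 2
      calc _ = W * Matrix.diagonal (fun i => (b i : ℂ)) * (Wᴴ * W)
            * Matrix.diagonal (fun i => (Real.log (b i) : ℂ)) * Wᴴ := by
            simp only [Matrix.mul_assoc]
        _ = _ := by
            rw [hW', Matrix.mul_one, Matrix.mul_assoc W, Matrix.diagonal_mul_diagonal]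
            simp only [Complex.ofReal_mul]
    have h2 : (B * cfc Real.log A).trace.re
        = ∑ k, b k.2 * Real.log (a k.1) * w k := by
      rw [hlρ, hσ, trace_mul_diagonal_mul, Fintype.sum_prod_type]
      refine Finset.sum_congr rfl fun i _ => Finset.sum_congr rfl fun j _ => ?_
      rw [mul_comm (Real.log _)]
    rw [Matrix.trace_sub, Complex.sub_re, h1, h2, ← Finset.sum_sub_distrib]
    refine Finset.sum_congr rfl fun k _ => ?_
    simp only [hq, hl]
    ring
  have hle : ∀ k, q k ≤ Real.exp (l k) * p k := by
    rintro ⟨i, j⟩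
    rcases (hb j).eq_or_lt with hbj | hbj
    · have : q (i, j) = 0 := by simp [hq, ← hbj]
      rw [this]
      exact mul_nonneg (Real.exp_pos _).le (hp0 _)
    rcases (ha i).eq_or_lt with hai | hai
    -- Here the kernel inclusion enters: the eigenvector `v i` is killed by `ρ`, hence by `σ`, so
    -- its overlap with an eigenvector for `b j > 0` is zero. The value `log 0 = 0` is therefore
    -- harmless.
    · have hx : A *ᵥ (V.col i) = 0 := by
        have h1 : A * V = V * Matrix.diagonal (fun i => (a i : ℂ)) := by
          rw [hρ, Matrix.mul_assoc, hV', Matrix.mul_one]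
        funext t
        have h2 := congrFun (congrFun h1 t) i
        rw [Matrix.mul_diagonal, ← hai, Complex.ofReal_zero, mul_zero] at h2
        exact h2
      have hx' : B *ᵥ (V.col i) = 0 := by
        have := hker (x := V.col i) (by simpa using hx)
        simpa using this
      have h3 : (Wᴴ * B * V) j i = 0 := by
        rw [Matrix.mul_assoc, Matrix.mul_apply]
        refine Finset.sum_eq_zero fun t _ => ?_
        have h4 : (B * V) t i = 0 := congrFun hx' t
        rw [h4, mul_zero]
      have h5 : Wᴴ * B * V = Matrix.diagonal (fun i => (b i : ℂ)) * (Vᴴ * W)ᴴ := by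
        rw [hσ, Matrix.conjTranspose_mul, Matrix.conjTranspose_conjTranspose]
        simp only [← Matrix.mul_assoc]
        rw [hW', Matrix.one_mul]
      rw [h5, Matrix.diagonal_mul, Matrix.conjTranspose_apply] at h3
      have h6 : (Vᴴ * W) i j = 0 := by
        have : (b j : ℂ) ≠ 0 := by exact_mod_cast hbj.ne'
        simpa [this] using h3
      simp [hq, hp, hw, h6]
    · refine le_of_eq ?_
      simp only [hl, hp, hq]
      rw [Real.exp_sub, Real.exp_log hbj, Real.exp_log hai]
      field_simp
  obtain ⟨s, hs, hg⟩ := exists_sum_mul_exp_lt_one hq1 (hql.trans_lt hc)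
  refine ⟨_, Finset.sum_nonneg fun k _ => mul_nonneg (hq0 k) (Real.exp_pos _).le, hg,
    fun N T hT hT' => ?_⟩
  have h1 := one_sub_pow_le_sum_min hp0 hq0 hq1 hle (c := c) hs N
  have hVN : tensorPower N V * (tensorPower N V)ᴴ = 1 := by
    rw [← tensorPower_conjTranspose, ← tensorPower_mul, hV, tensorPower_one]
  have hWN : tensorPower N W * (tensorPower N W)ᴴ = 1 := by
    rw [← tensorPower_conjTranspose, ← tensorPower_mul, hW, tensorPower_one]
  -- The weight `e^(Nc)` is absorbed into the eigenvalues of `ρ^{⊗N}`.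
  have h2 := sum_min_mul_normSq_le_trace hVN hWN
    (a := fun k => Real.exp (N * c) * ∏ t, a (k t)) (b := fun k => ∏ t, b (k t))
    (fun k => mul_nonneg (Real.exp_pos _).le (Finset.prod_nonneg fun t _ => ha _))
    (fun k => Finset.prod_nonneg fun t _ => hb _) hT hT'
  have e1 : tensorPower N V * Matrix.diagonal
        (fun k => ((Real.exp (N * c) * ∏ t, a (k t) : ℝ) : ℂ)) * (tensorPower N V)ᴴ
      = ((Real.exp (N * c) : ℝ) : ℂ) • tensorPower N A := by
    rw [hρ, tensorPower_mul, tensorPower_mul, tensorPower_diagonal, tensorPower_conjTranspose,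
      ← Matrix.smul_mul, ← Matrix.mul_smul, ← Matrix.diagonal_smul]
    congr 3
    funext k
    simp
  have e2 : tensorPower N W * Matrix.diagonal
        (fun k => ((∏ t, b (k t) : ℝ) : ℂ)) * (tensorPower N W)ᴴ = tensorPower N B := by
    rw [hσ, tensorPower_mul, tensorPower_mul, tensorPower_diagonal, tensorPower_conjTranspose]
  rw [e1, e2, Matrix.smul_mul, Matrix.trace_smul, smul_eq_mul, Complex.re_ofReal_mul] at h2
  refine le_trans (div_le_div_of_nonneg_right (h1.trans (le_of_eq ?_)) zero_le_two) h2
  rw [← (Equiv.arrowProdEquivProdArrow (Fin N) (fun _ => Fin d) (fun _ => Fin d)).symm.sum_comp,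
    Fintype.sum_prod_type]
  refine Finset.sum_congr rfl fun i _ => Finset.sum_congr rfl fun j _ => ?_
  have e3 : Complex.normSq (((tensorPower N V)ᴴ * tensorPower N W) i j)
      = ∏ t, w (i t, j t) := by
    rw [← tensorPower_conjTranspose, ← tensorPower_mul, tensorPower, Matrix.of_apply, map_prod]
  rw [e3, min_mul_of_nonneg _ _ (Finset.prod_nonneg fun t _ => hw0 _), mul_assoc,
    ← Finset.prod_mul_distrib, ← Finset.prod_mul_distrib]
  rfl

/-! ### Large deviations -/

theorem POVM.toVectorMeasure_compl {X : Type*} [MeasurableSpace X] {n : Type*} [Fintype n]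
    [DecidableEq n] (E : POVM X n) {Δ : Set X} (hΔ : MeasurableSet Δ) :
    E.toVectorMeasure Δᶜ = 1 - E.toVectorMeasure Δ := by
  rw [← E.univ_eq_one, ← VectorMeasure.of_add_of_sdiff hΔ MeasurableSet.univ (Set.subset_univ _),
    Set.compl_eq_univ_sdiff]
  abel

section LargeDeviations

variable {X : Type*} [TopologicalSpace X]

/-- On the compact part of `C` where `I ≤ 1` the minimum is attained, hence positive; elsewhere `I`
exceeds 1. -/
theorem IsRateFunction.iInf_pos {I : X → ℝ≥0∞} (hI : IsRateFunction I) {C : Set X}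
    (hC : IsClosed C) (hpos : ∀ y ∈ C, I y ≠ 0) : 0 < ⨅ y ∈ C, I y := by
  have hK : IsCompact ({y | I y ≤ (1 : ℝ≥0)} ∩ C) := (hI.isCompact_level 1).inter_right hC
  rcases ({y | I y ≤ (1 : ℝ≥0)} ∩ C).eq_empty_or_nonempty with h | h
  · refine lt_of_lt_of_le zero_lt_one (le_iInf₂ fun y hy => ?_)
    by_contra hlt
    exact h.subset ⟨by simpa using (not_le.mp hlt).le, hy⟩
  · obtain ⟨y, hy, hmin⟩ := hI.lowerSemicontinuous.lowerSemicontinuousOn _ |>.exists_isMinOn h hK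
    refine lt_of_lt_of_le (lt_min zero_lt_one (pos_iff_ne_zero.mpr (hpos y hy.2)))
      (le_iInf₂ fun z hz => ?_)
    rcases le_total (I z) 1 with h1 | h1
    · exact (min_le_right _ _).trans (hmin ⟨by simpa using h1, hz⟩)
    · exact (min_le_left _ _).trans h1

variable [MeasurableSpace X]

/-- A closed set on which the rate function does not vanish has asymptotically probability zero. -/
theorem SatisfiesLDP.eventually_le_of_isClosed {μ : ℕ → Measure X} [∀ N, IsProbabilityMeasure (μ N)]
    {I : X → ℝ≥0∞} (h : SatisfiesLDP μ I) {C : Set X} (hC : IsClosed C)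
    (hpos : ∀ y ∈ C, I y ≠ 0) {ε : ℝ} (hε : 0 < ε) :
    ∀ᶠ N in atTop, μ N C ≤ ENNReal.ofReal ε := by
  have h0 := h.isRateFunction.iInf_pos hC hpos
  have h1 : -((⨅ y ∈ C, I y : ℝ≥0∞) : EReal) < 0 := by
    rw [EReal.neg_lt_comm, neg_zero]
    exact_mod_cast h0
  obtain ⟨δ, hδ1, hδ2⟩ := EReal.lt_iff_exists_real_btwn.mp ((h.upper_bound C hC).trans_lt h1)
  have hδ : δ < 0 := by exact_mod_cast hδ2
  have hlim : Tendsto (fun N : ℕ => Real.exp (δ * N)) atTop (𝓝 0) :=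
    Real.tendsto_exp_atBot.comp (tendsto_natCast_atTop_atTop.const_mul_atTop_of_neg hδ)
  filter_upwards [eventually_lt_of_limsup_lt hδ1, hlim.eventually (gt_mem_nhds hε),
    eventually_gt_atTop 0] with N hN hexp hN0
  have hN' : (0 : EReal) < (N : EReal) := by exact_mod_cast hN0
  rw [EReal.div_lt_iff hN' (EReal.natCast_ne_top N)] at hN
  have hle : ENNReal.log (μ N C) ≤ ENNReal.log (ENNReal.ofReal (Real.exp (δ * N))) := by
    rw [ENNReal.log_ofReal_of_pos (Real.exp_pos _), Real.log_exp]
    refine hN.le.trans (le_of_eq ?_)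
    push_cast
    rfl
  exact (ENNReal.log_le_log_iff.mp hle).trans (ENNReal.ofReal_le_ofReal hexp.le)

/-- If the probability of a closed set decays at most with rate `c`, then the rate function has
infimum at most `c` on it. -/
theorem SatisfiesLDP.iInf_le_of_eventually_le {μ : ℕ → Measure X}
    [∀ N, IsProbabilityMeasure (μ N)]
    {I : X → ℝ≥0∞} (h : SatisfiesLDP μ I) {C : Set X} (hC : IsClosed C) {c k : ℝ} (hk : 0 < k)
    (hle : ∀ᶠ N : ℕ in atTop, ENNReal.ofReal (Real.exp (-(N * c)) * k) ≤ μ N C) :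
    ((⨅ y ∈ C, I y : ℝ≥0∞) : EReal) ≤ c := by
  rw [← EReal.neg_le_neg_iff]
  refine le_trans ?_ (h.upper_bound C hC)
  -- The constant `k` changes the rate only by `log k / N`, which tends to 0.
  have hlim : Tendsto (fun N : ℕ => ((-c + Real.log k / N : ℝ) : EReal)) atTop
      (𝓝 ((-c : ℝ) : EReal)) := by
    refine (continuous_coe_real_ereal.tendsto _).comp ?_
    simpa using (tendsto_const_div_atTop_nhds_zero_nat (Real.log k)).const_add (-c)
  rw [← EReal.coe_neg, ← hlim.limsup_eq]
  refine limsup_le_limsup ?_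
  filter_upwards [hle, eventually_gt_atTop 0] with N hN hN0
  have hN' : (0 : EReal) < (N : EReal) := by exact_mod_cast hN0
  rw [EReal.le_div_iff_mul_le hN' (EReal.natCast_ne_top N)]
  have h1 := ENNReal.log_monotone hN
  rw [ENNReal.log_ofReal_of_pos (by positivity), Real.log_mul (Real.exp_pos _).ne' hk.ne',
    Real.log_exp] at h1
  refine le_trans (le_of_eq ?_) h1
  rw [← EReal.coe_coe_eq_natCast, ← EReal.coe_mul, EReal.coe_eq_coe_iff]
  have : (N : ℝ) ≠ 0 := by exact_mod_cast hN0.ne'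
  field_simp

end LargeDeviations

theorem EstimationScheme.HasRateFunction.le_relativeEntropy {d : ℕ} {X : Type*} [MetricSpace X]
    [MeasurableSpace X] [BorelSpace X] {p : DensityMatrix d → X} {E : EstimationScheme d X}
    {I : DensityMatrix d → X → ℝ≥0∞} (h : E.HasRateFunction p I) (ρ σ : DensityMatrix d) :
    (I ρ (p σ) : EReal) ≤ relativeEntropy ρ σ := by
  rw [relativeEntropy]
  split_ifs with hker
  swap
  · exact le_top
  refine EReal.le_of_forall_lt_iff_le.mp fun c hc => ?_
  obtain ⟨g, hg0, hg1, hg⟩ := exists_one_sub_pow_le_trace ρ σ hker (EReal.coe_lt_coe_iff.mp hc)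
  have key : ∀ r : ℝ, 0 < r →
      ((⨅ y ∈ Metric.closedBall (p σ) r, I ρ y : ℝ≥0∞) : EReal) ≤ c := by
    intro r hr
    -- Once `g^N < 1/2`, the error sum is at least `1/4`; the `σ`-error takes at most `1/8`, leaving
    -- `1/8`.
    refine (h.ldp ρ).iInf_le_of_eventually_le Metric.isClosed_closedBall
      (k := 1 / 8) (by norm_num) ?_
    have h1 := (h.ldp σ).eventually_le_of_isClosed (C := (Metric.ball (p σ) r)ᶜ)
      Metric.isOpen_ball.isClosed_compl
      (fun y hy h0 => hy (by
        rw [← (h.eq_zero_iff σ y).mp h0]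
        exact Metric.mem_ball_self hr))
      (ε := 1 / 8) (by norm_num)
    have h2 := (tendsto_pow_atTop_nhds_zero_of_lt_one hg0 hg1).eventually
      (gt_mem_nhds (show (0 : ℝ) < 1 / 2 by norm_num))
    filter_upwards [h1, h2] with N hN hgN
    refine le_trans ?_ (measure_mono Metric.ball_subset_closedBall)
    have hm : MeasurableSet (Metric.ball (p σ) r) := measurableSet_ball
    rw [outcomeMeasure_apply _ _ hm.compl, ENNReal.ofReal_le_ofReal_iff (by norm_num),
      POVM.toVectorMeasure_compl _ hm] at hN
    rw [outcomeMeasure_apply _ _ hm]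
    refine ENNReal.ofReal_le_ofReal ?_
    have hT := (E N).posSemidef _ hm.compl
    rw [POVM.toVectorMeasure_compl _ hm] at hT
    have h3 := hg N _ ((E N).posSemidef _ hm) hT
    rw [Real.exp_neg, inv_mul_le_iff₀ (Real.exp_pos _)]
    linarith
  -- Otherwise lower semicontinuity keeps `I ρ` above some `c' > c` on a closed ball, against `key`.
  by_contra hlt
  have hlsc : LowerSemicontinuous fun y => (I ρ y : EReal) :=
    continuous_coe_ennreal_ereal.comp_lowerSemicontinuous (h.isRateFunction ρ).lowerSemicontinuous
      EReal.coe_ennreal_strictMono.monotone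
  obtain ⟨c', hc1, hc2⟩ := EReal.lt_iff_exists_real_btwn.mp (not_le.mp hlt)
  obtain ⟨r, hr, hsub⟩ := Metric.nhds_basis_closedBall.mem_iff.mp (hlsc (p σ) c' hc2)
  refine absurd (key r hr) (not_le.mpr (lt_of_lt_of_le hc1 ?_))
  -- Nothing yet excludes `c' < 0`; truncating at 0 only raises it.
  have hle : ENNReal.ofReal c' ≤ ⨅ y ∈ Metric.closedBall (p σ) r, I ρ y := by
    refine le_iInf₂ fun y hy => ?_
    rw [← EReal.coe_ennreal_le_coe_ennreal_iff, EReal.coe_ennreal_ofReal]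
    rcases le_total c' 0 with h0 | h0
    · rw [max_eq_right h0]
      exact EReal.coe_ennreal_nonneg _
    · rw [max_eq_left h0]
      exact (hsub hy).le
  refine le_trans ?_ (EReal.coe_ennreal_le_coe_ennreal_iff.mpr hle)
  rw [EReal.coe_ennreal_ofReal]
  exact EReal.coe_le_coe_iff.mpr (le_max_left _ _)

/-- Klein's inequality. -/
theorem relativeEntropy_nonneg {d : ℕ} (ρ σ : DensityMatrix d) : 0 ≤ relativeEntropy ρ σ := by
  rw [relativeEntropy]
  split_ifs with hker
  swap
  · exact le_top
  rw [EReal.coe_nonneg]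
  by_contra hlt
  obtain ⟨c, hc, hc0⟩ := exists_between (not_le.mp hlt)
  obtain ⟨g, hg0, hg1, hg⟩ := exists_one_sub_pow_le_trace ρ σ hker hc
  have hlim : Tendsto (fun N : ℕ => Real.exp (c * N)) atTop (𝓝 0) :=
    Real.tendsto_exp_atBot.comp (tendsto_natCast_atTop_atTop.const_mul_atTop_of_neg hc0)
  obtain ⟨N, h1, h2⟩ := ((hlim.eventually (gt_mem_nhds (show (0 : ℝ) < 1 / 4 by norm_num))).and
    ((tendsto_pow_atTop_nhds_zero_of_lt_one hg0 hg1).eventually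
      (gt_mem_nhds (show (0 : ℝ) < 1 / 2 by norm_num)))).exists
  -- The test that always accepts `σ` has no `σ`-error, so `(1 - g^N)/2 ≤ e^(Nc)`, which fails for
  -- `c < 0` and large `N`.
  have h3 := hg N 1 Matrix.PosSemidef.one (by simpa using Matrix.PosSemidef.zero)
  rw [sub_self, Matrix.mul_zero, Matrix.mul_one, tensorPower_trace, ρ.2.2, mul_comm (N : ℝ)] at h3
  simp only [one_pow, Complex.one_re, Matrix.trace_zero, Complex.zero_re] at h3
  linarith

end QuantumEstimation

theorem theorem5 {d : ℕ} {X : Type*} [MetricSpace X] [LocallyCompactSpace X]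
    [TopologicalSpace.SeparableSpace X] [MeasurableSpace X] [BorelSpace X]
    (p : QuantumEstimation.DensityMatrix d → X) (hp : Continuous p)
    (hp_onto : Function.Surjective p)
    (ρ : QuantumEstimation.DensityMatrix d) (x : X) :
    ((QuantumEstimation.optimalRateFunction p ρ x : ENNReal) : EReal)
      ≤ ⨅ σ ∈ p ⁻¹' {x}, QuantumEstimation.relativeEntropy ρ σ := by
  refine le_iInf₂ fun σ hσ => ?_
  obtain rfl : p σ = x := hσ
  -- The supremum lives in `[0, ∞]`, so the bound must be moved there, which requires its
  -- nonnegativity.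
  have h0 := QuantumEstimation.relativeEntropy_nonneg ρ σ
  rw [← EReal.coe_toENNReal h0, EReal.coe_ennreal_le_coe_ennreal_iff]
  refine iSup₂_le fun I hI => ?_
  obtain ⟨E, hE⟩ := hI
  rw [← EReal.coe_ennreal_le_coe_ennreal_iff, EReal.coe_toENNReal h0]
  exact hE.le_relativeEntropy ρ σ
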